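/- Let $d\ge 1$ and $n\ge 0$ be integers and let $\mathcal D_1,\mathcal D_2$ be compact sets (possibly of infinite cardinality) of density matrices on $\mathbb C^d$, that is, of positive semidefinite $d\times d$ complex matrices of trace $1$. For $i=1,2$ put $$\mathcal D_{i,n}=\{\rho^{\otimes n}:\rho\in\mathcal D_i\},\qquad \mathcal C_{i,n}=\operatorname{conv}(\mathcal D_{i,n}).$$ Let $F(\rho,\sigma)=\|\sqrt\rho\sqrt\sigma\|_1$, with $\|A\|_1=\operatorname{tr}\sqrt{A^\dagger A}$, be the (square-root) Uhlmann fidelity, let $F_{\max}=\sup_{\rho_1\in\mathcal D_1,\rho_2\in\mathcal D_2}F(\rho_1,\rho_2)$, and let $\dim_{\mathbb R}(\mathcal S)$ denote the real dimension of the smallest affine space containing a set $\mathcal S$ (with $\dim_{\mathbb R}(\emptyset)=0$ and $\sup\emptyset=0$ if some $\mathcal D_i$ is empty). Then both suprema below are finite and $$\sup_{\sigma_{1,n}\in\mathcal C_{1,n},\,\sigma_{2,n}\in\mathcal C_{2,n}}F(\sigma_{1,n},\sigma_{2,n})\le\Bigl(\max_{i=1,2}\dim_{\mathbb R}(\mathcal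 D_{i,n})+1\Bigr)F_{\max}^{\,n}.$$ Moreover, for each $i=1,2$, $$\dim_{\mathbb R}(\mathcal D_{i,n})+1\le\binom{n+d^2-1}{n},$$ and the binomial coefficient on the right is the real dimension of the space of Hermitian operators $A$ on $(\mathbb C^d)^{\otimes n}$ with $V(\pi)AV(\pi)^\dagger=A$ for every permutation $\pi$ of $\{1,\dots,n\}$, where $V(\pi)$ is the unitary permuting the $n$ tensor factors according to $\pi$. -/

import Mathlib

open scoped MatrixOrder ComplexOrder Matrix

noncomputable section

namespace CompositeQHT

/-- Density matrices on `ℂ^d`: positive semidefinite (hence Hermitian) matrices of unit trace. -/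
def densityMatrices (d : ℕ) : Set (Matrix (Fin d) (Fin d) ℂ) :=
  {ρ | ρ.PosSemidef ∧ ρ.trace = 1}

/-- The trace norm `‖A‖₁ = tr √(A† A)`; the trace is a nonnegative real number. -/
def traceNorm {ι : Type*} [Fintype ι] [DecidableEq ι] (A : Matrix ι ι ℂ) : ℝ :=
  (CFC.sqrt (Aᴴ * A)).trace.re

/-- The (square root) Uhlmann fidelity `F(ρ, σ) = ‖√ρ √σ‖₁`. -/
def fidelity {ι : Type*} [Fintype ι] [DecidableEq ι] (ρ σ : Matrix ι ι ℂ) : ℝ :=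
  traceNorm (CFC.sqrt ρ * CFC.sqrt σ)

/-- The values `F(ρ, σ)` for `ρ ∈ A` and `σ ∈ B`. -/
def fidelityValues {ι : Type*} [Fintype ι] [DecidableEq ι] (A B : Set (Matrix ι ι ℂ)) : Set ℝ :=
  Set.image2 fidelity A B

/-- The supremum of `F(ρ, σ)` over `ρ ∈ A` and `σ ∈ B`. -/
def supFidelity {ι : Type*} [Fintype ι] [DecidableEq ι] (A B : Set (Matrix ι ι ℂ)) : ℝ :=
  sSup (fidelityValues A B)

/-- The tensor power `ρ^{⊗n}` as a matrix on `(ℂ^d)^{⊗n}`, whose standard basis vectors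
`e_{i 0} ⊗ ⋯ ⊗ e_{i (n-1)}` are indexed by `i : Fin n → Fin d`. -/
def tensorPow {d : ℕ} (n : ℕ) (ρ : Matrix (Fin d) (Fin d) ℂ) :
    Matrix (Fin n → Fin d) (Fin n → Fin d) ℂ :=
  Matrix.of fun i j => ∏ k, ρ (i k) (j k)

/-- The set `{ρ^{⊗n} : ρ ∈ D}`. -/
def copies {d : ℕ} (n : ℕ) (D : Set (Matrix (Fin d) (Fin d) ℂ)) :
    Set (Matrix (Fin n → Fin d) (Fin n → Fin d) ℂ) :=
  tensorPow n '' D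

/-- The convex hull of `{ρ^{⊗n} : ρ ∈ D}`. -/
def hullCopies {d : ℕ} (n : ℕ) (D : Set (Matrix (Fin d) (Fin d) ℂ)) :
    Set (Matrix (Fin n → Fin d) (Fin n → Fin d) ℂ) :=
  convexHull ℝ (copies n D)

/-- The real dimension of the smallest affine space containing the set `S`. -/
def affineDim {ι : Type*} (S : Set (Matrix ι ι ℂ)) : ℕ :=
  Module.finrank ℝ (affineSpan ℝ S).direction

/-- The unitary `V(π)` on `(ℂ^d)^{⊗n}` permuting the tensor factors:
it sends `e_{j 0} ⊗ ⋯ ⊗ e_{j (n-1)}` to the basis vector indexed by `j ∘ π⁻¹`. -/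
def permOp (d n : ℕ) (π : Equiv.Perm (Fin n)) : Matrix (Fin n → Fin d) (Fin n → Fin d) ℂ :=
  Matrix.of fun i j => if i = j ∘ ⇑π⁻¹ then 1 else 0

/-- The real vector space of permutation-invariant Hermitian operators on `(ℂ^d)^{⊗n}`. -/
def permInvariant (d n : ℕ) : Submodule ℝ (Matrix (Fin n → Fin d) (Fin n → Fin d) ℂ) where
  carrier := {A | A.IsHermitian ∧ ∀ π : Equiv.Perm (Fin n),
    permOp d n π * A * (permOp d n π)ᴴ = A}
  zero_mem' := by simp
  add_mem' := by
    rintro A B ⟨hA, hA'⟩ ⟨hB, hB'⟩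
    exact ⟨hA.add hB, fun π => by rw [mul_add, add_mul, hA', hB']⟩
  smul_mem' := by
    rintro c A ⟨hA, hA'⟩
    refine ⟨?_, fun π => by rw [Matrix.mul_smul, Matrix.smul_mul, hA']⟩
    simp [Matrix.IsHermitian, Matrix.conjTranspose_smul, hA.eq]

end CompositeQHT

end

/-!
For a contraction `K` one has `Re tr (K A) ≤ ‖A‖₁`, with equality for some `K`. If
`Aᴴ A ≤ ∑ i, Bᵢᴴ Bᵢ`, Douglas' lemma factors `A` through the column of the `Bᵢ` by a contraction,
so `‖A‖₁ ≤ ∑ i, ‖Bᵢ‖₁`. Applied to `A = √ρ √σ`, for which `Aᴴ A = √σ ρ √σ` is linear in `ρ`, this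
makes `F(·, σ)` subadditive. As `F(w ρ, σ) = √w F(ρ, σ)`, a mixture of `k` states with
`F(ρᵢ, σ) ≤ m` satisfies `F(∑ wᵢ ρᵢ, σ) ≤ ∑ √wᵢ m ≤ √k m`. By Carathéodory's theorem `k` can be
taken at most one more than the affine dimension; doing this in both arguments gives the geometric
mean of the two constants, and `F` is multiplicative on tensor powers.

The entries of a permutation-invariant matrix depend only on the multiset of index pairs
`(iₖ, jₖ)`, and a Hermitian matrix is determined by the numbers `Re Aᵢⱼ + Im Aᵢⱼ`, which are
otherwise arbitrary. So the invariant Hermitian matrices have as many real dimensions as there are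
multisets of `n` out of `d ^ 2` pairs. Tensor powers of states lie in this space on the hyperplane
of trace one, which misses the origin: hence the `+ 1`.
-/

namespace CompositeQHT

section Contraction

variable {m n p 𝕜 : Type*} [RCLike 𝕜] [Fintype m]

/-- A contraction `K`, expressed in the Loewner order: `Kᴴ * K ≤ 1`, equivalently the `ℓ²` operator
norm of `K` is at most `1`. The fidelity is estimated by pairing matrices with contractions, which
have to be allowed to be rectangular. -/
def IsContraction [DecidableEq n] (K : Matrix m n 𝕜) : Prop :=
  Kᴴ * K ≤ 1

theorem conjTranspose_mul_mul_mono [Finite n] {A B : Matrix m m 𝕜} (h : A ≤ B) (C : Matrix m n 𝕜) :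
    Cᴴ * A * C ≤ Cᴴ * B * C := by
  rw [Matrix.le_iff, ← Matrix.sub_mul, ← Matrix.mul_sub]
  exact (Matrix.le_iff.1 h).conjTranspose_mul_mul_same C

namespace IsContraction

theorem conjTranspose [Fintype n] [DecidableEq m] [DecidableEq n] {K : Matrix m n 𝕜}
    (hK : IsContraction K) : IsContraction Kᴴ := by
  set P := K * Kᴴ with hP
  have hPP : P * P ≤ P :=
    calc P * P = Kᴴᴴ * (Kᴴ * K) * Kᴴ := by
          simp only [hP, Matrix.conjTranspose_conjTranspose, Matrix.mul_assoc]
      _ ≤ Kᴴᴴ * 1 * Kᴴ := conjTranspose_mul_mul_mono hK Kᴴ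
      _ = P := by rw [Matrix.conjTranspose_conjTranspose, Matrix.mul_one]
  have hsq : 0 ≤ (1 - P) * (1 - P) :=
    (IsSelfAdjoint.one _ |>.sub (Matrix.isHermitian_mul_conjTranspose_self K)).mul_self_nonneg
  rw [IsContraction, Matrix.conjTranspose_conjTranspose, ← hP, ← sub_nonneg]
  -- positivity of `1 - P` is read off from `P ^ 2 ≤ P`
  calc 0 ≤ (1 - P) * (1 - P) + (P - P * P) := add_nonneg hsq (sub_nonneg.2 hPP)
    _ = 1 - P := by noncomm_ring

theorem mul [Fintype n] [Finite p] [DecidableEq n] [DecidableEq p]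
    {K : Matrix m n 𝕜} {L : Matrix n p 𝕜} (hK : IsContraction K) (hL : IsContraction L) :
    IsContraction (K * L) :=
  calc (K * L)ᴴ * (K * L) = Lᴴ * (Kᴴ * K) * L := by
        simp only [Matrix.conjTranspose_mul, Matrix.mul_assoc]
    _ ≤ Lᴴ * 1 * L := conjTranspose_mul_mul_mono hK L
    _ ≤ 1 := by rwa [Matrix.mul_one]

theorem submatrix_id [Finite n] [DecidableEq n] [DecidableEq p] {K : Matrix m n 𝕜}
    (hK : IsContraction K) {e : p → n} (he : Function.Injective e) :
    IsContraction (K.submatrix id e) := by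
  have h := Matrix.PosSemidef.submatrix (Matrix.le_iff.1 hK) e
  rwa [Matrix.submatrix_sub, Pi.sub_apply, Pi.sub_apply, Matrix.submatrix_one e he] at h

end IsContraction

theorem exists_pseudoInverse [Fintype n] {P : Matrix n n 𝕜} (hP : P.IsHermitian) :
    ∃ T : Matrix n n 𝕜, T.IsHermitian ∧ P * T * P = P ∧ T * P * T = T := by
  classical
  have hPsa : IsSelfAdjoint P := hP
  have hcont (f : ℝ → ℝ) : ContinuousOn f (spectrum ℝ P) :=
    Matrix.finite_real_spectrum.continuousOn f
  have hmul (f g h : ℝ → ℝ) :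
      cfc f P * cfc g P * cfc h P = cfc (fun x => f x * g x * h x) P := by
    rw [← cfc_mul f g P (hcont f) (hcont g), ← cfc_mul _ h P (hcont _) (hcont h)]
  have hinv (x : ℝ) : x⁻¹ * x * x⁻¹ = x⁻¹ := by simpa only [inv_inv] using mul_inv_mul_cancel x⁻¹
  refine ⟨cfc (·⁻¹ : ℝ → ℝ) P, cfc_predicate _ P, ?_, ?_⟩
  · simpa only [mul_inv_mul_cancel, cfc_id' ℝ P] using hmul (fun x => x) (·⁻¹) (fun x => x)
  · simpa only [hinv, cfc_id' ℝ P] using hmul (·⁻¹) (fun x => x) (·⁻¹)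

/-- Douglas' factorization lemma. The contraction is `A * T * Bᴴ` for a pseudo-inverse `T` of
`Bᴴ * B`, because `B * T * Bᴴ` is then an orthogonal projection. -/
theorem exists_isContraction_mul_eq [Finite n] [Fintype p] [DecidableEq p]
    {A : Matrix m n 𝕜} {B : Matrix p n 𝕜} (h : Aᴴ * A ≤ Bᴴ * B) :
    ∃ K : Matrix m p 𝕜, IsContraction K ∧ K * B = A := by
  classical
  cases nonempty_fintype n
  set P := Bᴴ * B with hP
  have hPh : P.IsHermitian := Matrix.isHermitian_conjTranspose_mul_self B
  obtain ⟨T, hT, hPTP, hTPT⟩ := exists_pseudoInverse hPh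
  have hproj : IsStarProjection (B * T * Bᴴ) := by
    refine ⟨?_, Matrix.isHermitian_mul_mul_conjTranspose B hT⟩
    calc B * T * Bᴴ * (B * T * Bᴴ) = B * (T * P * T) * Bᴴ := by simp only [hP, Matrix.mul_assoc]
      _ = B * T * Bᴴ := by rw [hTPT]
  refine ⟨A * T * Bᴴ, ?_, ?_⟩
  · calc (A * T * Bᴴ)ᴴ * (A * T * Bᴴ) = (T * Bᴴ)ᴴ * (Aᴴ * A) * (T * Bᴴ) := by
          simp only [Matrix.conjTranspose_mul, Matrix.mul_assoc]
      _ ≤ (T * Bᴴ)ᴴ * P * (T * Bᴴ) := conjTranspose_mul_mul_mono h _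
      _ = B * (T * P * T) * Bᴴ := by
          simp only [Matrix.conjTranspose_mul, Matrix.conjTranspose_conjTranspose, hT.eq,
            Matrix.mul_assoc]
      _ ≤ 1 := by rw [hTPT]; exact hproj.le_one
  · have hzero : (A * (1 - T * P))ᴴ * (A * (1 - T * P)) = 0 := by
      refine le_antisymm ?_ (Matrix.posSemidef_conjTranspose_mul_self _).nonneg
      calc (A * (1 - T * P))ᴴ * (A * (1 - T * P)) = (1 - T * P)ᴴ * (Aᴴ * A) * (1 - T * P) := by
            simp only [Matrix.conjTranspose_mul, Matrix.mul_assoc]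
        _ ≤ (1 - T * P)ᴴ * P * (1 - T * P) := conjTranspose_mul_mul_mono h _
        _ = 0 := by
            rw [Matrix.mul_assoc, mul_sub, mul_one, ← mul_assoc P, hPTP, sub_self, mul_zero]
    rw [Matrix.conjTranspose_mul_self_eq_zero, Matrix.mul_sub, Matrix.mul_one,
      sub_eq_zero] at hzero
    rw [Matrix.mul_assoc, ← hP, Matrix.mul_assoc, ← hzero]

theorem re_trace_mono {A B : Matrix m m 𝕜} (h : A ≤ B) : RCLike.re A.trace ≤ RCLike.re B.trace :=
  (RCLike.le_iff_re_im.1 ((Matrix.tracePositiveLinearMap m ℝ 𝕜).monotone' h)).1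

theorem two_mul_re_trace_conjTranspose_mul_le [Fintype n] (A B : Matrix m n 𝕜) :
    2 * RCLike.re (Aᴴ * B).trace ≤ RCLike.re (Aᴴ * A).trace + RCLike.re (Bᴴ * B).trace := by
  have hnonneg := re_trace_mono (Matrix.posSemidef_conjTranspose_mul_self (A - B)).nonneg
  have hsymm : RCLike.re (Bᴴ * A).trace = RCLike.re (Aᴴ * B).trace := by
    rw [← RCLike.conj_re, starRingEnd_apply, ← Matrix.trace_conjTranspose,
      Matrix.conjTranspose_mul, Matrix.conjTranspose_conjTranspose]
  simp only [Matrix.conjTranspose_sub, Matrix.sub_mul, Matrix.mul_sub, Matrix.trace_sub,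
    Matrix.trace_zero, map_sub, map_zero] at hnonneg
  linarith

theorem IsContraction.two_mul_re_trace_mul_le [Fintype n] [Fintype p] [DecidableEq p]
    {K : Matrix n p 𝕜} (hK : IsContraction K) (A : Matrix m p 𝕜) (B : Matrix m n 𝕜) :
    2 * RCLike.re (K * (Aᴴ * B)).trace ≤ RCLike.re (Aᴴ * A).trace + RCLike.re (Bᴴ * B).trace :=
  calc 2 * RCLike.re (K * (Aᴴ * B)).trace = 2 * RCLike.re ((A * Kᴴ)ᴴ * B).trace := by
        rw [Matrix.conjTranspose_mul, Matrix.conjTranspose_conjTranspose, Matrix.mul_assoc]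
    _ ≤ RCLike.re ((A * Kᴴ)ᴴ * (A * Kᴴ)).trace + RCLike.re (Bᴴ * B).trace :=
        two_mul_re_trace_conjTranspose_mul_le _ _
    _ = RCLike.re (Aᴴᴴ * (Kᴴ * K) * Aᴴ).trace + RCLike.re (Bᴴ * B).trace := by
        rw [Matrix.trace_mul_comm (A * Kᴴ)ᴴ]
        simp only [Matrix.conjTranspose_mul, Matrix.conjTranspose_conjTranspose, Matrix.mul_assoc]
    _ ≤ RCLike.re (Aᴴᴴ * (1 : Matrix p p 𝕜) * Aᴴ).trace + RCLike.re (Bᴴ * B).trace :=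
        add_le_add (re_trace_mono (conjTranspose_mul_mul_mono hK Aᴴ)) le_rfl
    _ = RCLike.re (Aᴴ * A).trace + RCLike.re (Bᴴ * B).trace := by
        rw [Matrix.conjTranspose_conjTranspose, Matrix.mul_one, Matrix.trace_mul_comm]

theorem IsContraction.re_trace_mul_le_of_posSemidef [DecidableEq m] {K P : Matrix m m 𝕜}
    (hK : IsContraction K) (hP : P.PosSemidef) : RCLike.re (K * P).trace ≤ RCLike.re P.trace := by
  obtain ⟨R, rfl⟩ := CStarAlgebra.nonneg_iff_eq_star_mul_self.1 hP.nonneg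
  rw [Matrix.star_eq_conjTranspose]
  linarith [hK.two_mul_re_trace_mul_le R R]

end Contraction

section TraceNorm

variable {ι : Type*} [Fintype ι] [DecidableEq ι]

theorem posSemidef_sqrt (A : Matrix ι ι ℂ) : (CFC.sqrt A).PosSemidef :=
  Matrix.nonneg_iff_posSemidef.1 (CFC.sqrt_nonneg A)

theorem traceNorm_nonneg (A : Matrix ι ι ℂ) : 0 ≤ traceNorm A :=
  (Complex.nonneg_iff.1 (posSemidef_sqrt (Aᴴ * A)).trace_nonneg).1

theorem conjTranspose_sqrt_mul_sqrt {A : Matrix ι ι ℂ} (hA : A.PosSemidef) :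
    (CFC.sqrt A)ᴴ * CFC.sqrt A = A := by
  rw [(posSemidef_sqrt A).1.eq, CFC.sqrt_mul_sqrt_self A hA.nonneg]

theorem exists_isContraction_traceNorm_eq (A : Matrix ι ι ℂ) :
    ∃ K : Matrix ι ι ℂ, IsContraction K ∧ traceNorm A = (K * A).trace.re := by
  obtain ⟨K, hK, hKA⟩ := exists_isContraction_mul_eq
    (conjTranspose_sqrt_mul_sqrt (Matrix.posSemidef_conjTranspose_mul_self A)).le
  exact ⟨K, hK, by rw [traceNorm, hKA]⟩

theorem IsContraction.re_trace_mul_le_traceNorm {K : Matrix ι ι ℂ} (hK : IsContraction K)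
    (A : Matrix ι ι ℂ) : (K * A).trace.re ≤ traceNorm A := by
  obtain ⟨L, hL, hLA⟩ := exists_isContraction_mul_eq
    (conjTranspose_sqrt_mul_sqrt (Matrix.posSemidef_conjTranspose_mul_self A)).ge
  calc (K * A).trace.re = (K * L * CFC.sqrt (Aᴴ * A)).trace.re := by rw [mul_assoc, hLA]
    _ ≤ traceNorm A :=
      (hK.mul hL).re_trace_mul_le_of_posSemidef (posSemidef_sqrt (Aᴴ * A))

theorem traceNorm_conjTranspose_le (A : Matrix ι ι ℂ) : traceNorm Aᴴ ≤ traceNorm A := by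
  obtain ⟨K, hK, hKA⟩ := exists_isContraction_traceNorm_eq Aᴴ
  calc traceNorm Aᴴ = (Kᴴ * A).trace.re := by
        rw [hKA, ← Complex.conj_re, starRingEnd_apply, ← Matrix.trace_conjTranspose,
          Matrix.conjTranspose_mul, Matrix.conjTranspose_conjTranspose, Matrix.trace_mul_comm]
    _ ≤ traceNorm A := hK.conjTranspose.re_trace_mul_le_traceNorm A

theorem traceNorm_conjTranspose (A : Matrix ι ι ℂ) : traceNorm Aᴴ = traceNorm A :=
  (traceNorm_conjTranspose_le A).antisymm <| by
    simpa only [Matrix.conjTranspose_conjTranspose] using traceNorm_conjTranspose_le Aᴴ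

theorem traceNorm_smul {c : ℝ} (hc : 0 ≤ c) (A : Matrix ι ι ℂ) :
    traceNorm (c • A) = c * traceNorm A := by
  have hsqrt : CFC.sqrt ((c • A)ᴴ * (c • A)) = c • CFC.sqrt (Aᴴ * A) := by
    refine CFC.sqrt_unique ?_ (smul_nonneg hc (CFC.sqrt_nonneg _))
    rw [smul_mul_smul_comm, CFC.sqrt_mul_sqrt_self _
      (Matrix.posSemidef_conjTranspose_mul_self A).nonneg, Matrix.conjTranspose_smul,
      smul_mul_smul_comm, star_trivial]
  rw [traceNorm, hsqrt, Matrix.trace_smul, Complex.smul_re, smul_eq_mul, traceNorm]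

theorem traceNorm_le_sum {κ : Type*} [Fintype κ] {A : Matrix ι ι ℂ} {B : κ → Matrix ι ι ℂ}
    (h : Aᴴ * A ≤ ∑ i, (B i)ᴴ * B i) : traceNorm A ≤ ∑ i, traceNorm (B i) := by
  classical
  -- `A` factors through the column `C` of the blocks `B i`
  let C : Matrix (κ × ι) ι ℂ := Matrix.of fun p j => B p.1 p.2 j
  have hC : Cᴴ * C = ∑ i, (B i)ᴴ * B i := by
    ext j k
    simp only [C, Matrix.mul_apply, Matrix.conjTranspose_apply, Matrix.of_apply, Matrix.sum_apply,
      Fintype.sum_prod_type]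
  obtain ⟨K, hK, hKC⟩ := exists_isContraction_mul_eq (h.trans_eq hC.symm)
  obtain ⟨L, hL, hLA⟩ := exists_isContraction_traceNorm_eq A
  let block (i : κ) : Matrix ι ι ℂ := (L * K).submatrix id (Prod.mk i)
  have hblock (i : κ) : IsContraction (block i) :=
    (hL.mul hK).submatrix_id (Prod.mk_right_injective i)
  have hsum : L * A = ∑ i, block i * B i := by
    rw [← hKC, ← Matrix.mul_assoc]
    ext j k
    simp only [block, C, Matrix.mul_apply (M := L * K), Matrix.mul_apply (N := B _),
      Matrix.of_apply, Matrix.submatrix_apply, id_eq, Matrix.sum_apply, Fintype.sum_prod_type]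
  rw [hLA, hsum, Matrix.trace_sum, Complex.re_sum]
  exact Finset.sum_le_sum fun i _ => (hblock i).re_trace_mul_le_traceNorm (B i)

end TraceNorm

section Fidelity

variable {ι κ : Type*} [Fintype ι] [DecidableEq ι] [Fintype κ]

theorem fidelity_nonneg (ρ σ : Matrix ι ι ℂ) : 0 ≤ fidelity ρ σ :=
  traceNorm_nonneg _

theorem fidelity_comm (ρ σ : Matrix ι ι ℂ) : fidelity ρ σ = fidelity σ ρ := by
  rw [fidelity, ← traceNorm_conjTranspose, Matrix.conjTranspose_mul,
    (posSemidef_sqrt ρ).1.eq, (posSemidef_sqrt σ).1.eq, fidelity]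

theorem two_mul_fidelity_le {ρ σ : Matrix ι ι ℂ} (hρ : ρ.PosSemidef) (hσ : σ.PosSemidef) :
    2 * fidelity ρ σ ≤ ρ.trace.re + σ.trace.re := by
  obtain ⟨K, hK, hKF⟩ := exists_isContraction_traceNorm_eq (CFC.sqrt ρ * CFC.sqrt σ)
  have h := hK.two_mul_re_trace_mul_le (CFC.sqrt ρ) (CFC.sqrt σ)
  rwa [conjTranspose_sqrt_mul_sqrt hρ, conjTranspose_sqrt_mul_sqrt hσ,
    (posSemidef_sqrt ρ).1.eq, RCLike.re_eq_complex_re, ← hKF] at h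

theorem fidelity_smul_left {c : ℝ} (hc : 0 ≤ c) {ρ : Matrix ι ι ℂ} (hρ : ρ.PosSemidef)
    (σ : Matrix ι ι ℂ) : fidelity (c • ρ) σ = √c * fidelity ρ σ := by
  have hsqrt : CFC.sqrt (c • ρ) = √c • CFC.sqrt ρ := by
    refine CFC.sqrt_unique ?_ (smul_nonneg (Real.sqrt_nonneg c) (CFC.sqrt_nonneg ρ))
    rw [smul_mul_smul_comm, Real.mul_self_sqrt hc, CFC.sqrt_mul_sqrt_self ρ hρ.nonneg]
  rw [fidelity, hsqrt, Matrix.smul_mul, traceNorm_smul (Real.sqrt_nonneg c), fidelity]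

theorem conjTranspose_mul_self_sqrt_mul_sqrt {ρ : Matrix ι ι ℂ} (hρ : ρ.PosSemidef)
    (σ : Matrix ι ι ℂ) : (CFC.sqrt ρ * CFC.sqrt σ)ᴴ * (CFC.sqrt ρ * CFC.sqrt σ) =
      (CFC.sqrt σ)ᴴ * ρ * CFC.sqrt σ := by
  rw [Matrix.conjTranspose_mul, mul_assoc, ← mul_assoc _ (CFC.sqrt ρ),
    conjTranspose_sqrt_mul_sqrt hρ, mul_assoc]

theorem fidelity_sum_left_le {ρ : κ → Matrix ι ι ℂ} (hρ : ∀ i, (ρ i).PosSemidef)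
    (σ : Matrix ι ι ℂ) : fidelity (∑ i, ρ i) σ ≤ ∑ i, fidelity (ρ i) σ := by
  refine traceNorm_le_sum (le_of_eq ?_)
  simp only [conjTranspose_mul_self_sqrt_mul_sqrt (hρ _),
    conjTranspose_mul_self_sqrt_mul_sqrt (Matrix.posSemidef_sum Finset.univ fun i _ => hρ i),
    Finset.mul_sum, Finset.sum_mul]

theorem sum_sqrt_le_sqrt_card {w : κ → ℝ} (hw : ∀ i, 0 ≤ w i) (hw1 : ∑ i, w i = 1) :
    ∑ i, √(w i) ≤ √(Fintype.card κ) := by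
  refine Real.le_sqrt_of_sq_le ?_
  simpa only [Real.sq_sqrt (hw _), hw1, mul_one, Finset.card_univ] using
    sq_sum_le_card_mul_sum_sq (s := Finset.univ) (f := fun i => √(w i))

theorem fidelity_mixture_left_le {w : κ → ℝ} (hw : ∀ i, 0 ≤ w i) (hw1 : ∑ i, w i = 1)
    {ρ : κ → Matrix ι ι ℂ} (hρ : ∀ i, (ρ i).PosSemidef) {σ : Matrix ι ι ℂ} {m : ℝ} (hm0 : 0 ≤ m)
    (hm : ∀ i, fidelity (ρ i) σ ≤ m) :
    fidelity (∑ i, w i • ρ i) σ ≤ √(Fintype.card κ) * m :=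
  calc fidelity (∑ i, w i • ρ i) σ
      ≤ ∑ i, fidelity (w i • ρ i) σ := fidelity_sum_left_le (fun i => (hρ i).smul (hw i)) σ
    _ = ∑ i, √(w i) * fidelity (ρ i) σ :=
        Finset.sum_congr rfl fun i _ => fidelity_smul_left (hw i) (hρ i) σ
    _ ≤ ∑ i, √(w i) * m := by gcongr with i; exact hm i
    _ = (∑ i, √(w i)) * m := (Finset.sum_mul ..).symm
    _ ≤ √(Fintype.card κ) * m := by gcongr; exact sum_sqrt_le_sqrt_card hw hw1

theorem fidelity_convexHull_left_le {A : Set (Matrix ι ι ℂ)} (hA : ∀ ρ ∈ A, ρ.PosSemidef)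
    {σ : Matrix ι ι ℂ} {m : ℝ} (hm : ∀ ρ ∈ A, fidelity ρ σ ≤ m)
    {ρ : Matrix ι ι ℂ} (hρ : ρ ∈ convexHull ℝ A) : fidelity ρ σ ≤ √(affineDim A + 1) * m := by
  obtain ⟨ρ₀, hρ₀⟩ := convexHull_nonempty_iff.1 ⟨ρ, hρ⟩
  have hm0 : 0 ≤ m := (fidelity_nonneg ρ₀ σ).trans (hm ρ₀ hρ₀)
  -- Carathéodory's theorem
  obtain ⟨κ, _, z, w, hz, hind, hw, hw1, rfl⟩ := eq_pos_convex_span_of_mem_convexHull hρ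
  have hmem (i) : z i ∈ A := hz ⟨i, rfl⟩
  have hcard : Fintype.card κ ≤ affineDim A + 1 := by
    rw [affineDim, direction_affineSpan]
    exact hind.card_le_finrank_succ.trans
      (Nat.succ_le_succ (Submodule.finrank_mono (vectorSpan_mono ℝ hz)))
  calc fidelity (∑ i, w i • z i) σ ≤ √(Fintype.card κ) * m :=
        fidelity_mixture_left_le (fun i => (hw i).le) hw1 (fun i => hA _ (hmem i)) hm0
          fun i => hm _ (hmem i)
    _ ≤ √(affineDim A + 1) * m := by gcongr; exact_mod_cast hcard

theorem fidelity_convexHull_le {A B : Set (Matrix ι ι ℂ)} (hA : ∀ ρ ∈ A, ρ.PosSemidef)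
    (hB : ∀ σ ∈ B, σ.PosSemidef) {m : ℝ} (hm : ∀ ρ ∈ A, ∀ σ ∈ B, fidelity ρ σ ≤ m)
    {ρ σ : Matrix ι ι ℂ} (hρ : ρ ∈ convexHull ℝ A) (hσ : σ ∈ convexHull ℝ B) :
    fidelity ρ σ ≤ √((affineDim A + 1) * (affineDim B + 1)) * m := by
  rw [Real.sqrt_mul (by positivity), mul_assoc]
  refine fidelity_convexHull_left_le hA (fun ρ' hρ' => ?_) hρ
  rw [fidelity_comm]
  refine fidelity_convexHull_left_le hB (fun σ' hσ' => ?_) hσ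
  rw [fidelity_comm]
  exact hm ρ' hρ' σ' hσ'

end Fidelity

section PermInvariant

variable {α : Type*} {d n : ℕ}

/-- The multiset of values of a tuple. Its fibres are the orbits of the permutations of the
positions, so `Sym α n` indexes these orbits. -/
def symOfFn (f : Fin n → α) : Sym α n :=
  ⟨Finset.univ.val.map f, by simp⟩

theorem symOfFn_comp_perm (f : Fin n → α) (π : Equiv.Perm (Fin n)) :
    symOfFn (f ∘ π) = symOfFn f :=
  Subtype.ext <| by
    simp only [symOfFn, ← Multiset.map_map, Multiset.map_univ_val_equiv]

theorem symOfFn_surjective : Function.Surjective (symOfFn : (Fin n → α) → Sym α n) := by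
  rintro ⟨⟨l⟩, rfl⟩
  refine ⟨l.get, Subtype.ext ?_⟩
  exact (Fin.univ_val_map l.get).trans (congrArg Multiset.ofList (List.ofFn_get l))

theorem exists_perm_of_symOfFn_eq {f g : Fin n → α}
    (h : symOfFn f = symOfFn g) : ∃ π : Equiv.Perm (Fin n), g = f ∘ π := by
  classical
  have hcard (a : α) : Fintype.card {k // g k = a} = Fintype.card {k // f k = a} := by
    have hcount := congrArg (fun q : Sym α n => q.1.count a) h.symm
    simp only [symOfFn, Multiset.count_map] at hcount
    simp only [Fintype.card_subtype, eq_comm (b := a)]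
    exact hcount
  let π : Equiv.Perm (Fin n) := Equiv.ofFiberEquiv fun a => Fintype.equivOfCardEq (hcard a)
  exact ⟨π, funext fun k => (Equiv.ofFiberEquiv_map _ k).symm⟩

theorem permOp_mul_mul_apply (π : Equiv.Perm (Fin n))
    (A : Matrix (Fin n → Fin d) (Fin n → Fin d) ℂ) (i j : Fin n → Fin d) :
    (permOp d n π * A * (permOp d n π)ᴴ) i j = A (i ∘ π) (j ∘ π) := by
  have hperm (i j : Fin n → Fin d) : i = j ∘ ⇑π⁻¹ ↔ i ∘ ⇑π = j :=
    Equiv.eq_comp_symm π i j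
  simp only [Matrix.mul_apply, Matrix.conjTranspose_apply, permOp, Matrix.of_apply, hperm]
  simp

theorem mem_permInvariant {A : Matrix (Fin n → Fin d) (Fin n → Fin d) ℂ} :
    A ∈ permInvariant d n ↔
      A.IsHermitian ∧ ∀ (π : Equiv.Perm (Fin n)) (i j), A (i ∘ π) (j ∘ π) = A i j := by
  simp only [← permOp_mul_mul_apply]
  exact and_congr_right fun _ => forall_congr' fun _ => Matrix.ext_iff.symm

theorem eq_of_re_add_im_eq {ι : Type*} {A B : Matrix ι ι ℂ} (hA : A.IsHermitian)
    (hB : B.IsHermitian) (h : ∀ i j, (A i j).re + (A i j).im = (B i j).re + (B i j).im) :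
    A = B := by
  ext i j
  have hij := h i j
  have hji := h j i
  rw [← hA.apply, ← hB.apply] at hji
  simp only [Complex.star_def, Complex.conj_re, Complex.conj_im] at hji
  apply Complex.ext <;> linarith

/-- The permutation-invariant Hermitian matrix in which the real and imaginary parts of each entry
add up to a prescribed real function of the orbit of the index pair. -/
noncomputable def permInvariantOfSym (d n : ℕ) :
    (Sym (Fin d × Fin d) n → ℝ) →ₗ[ℝ] permInvariant d n where
  toFun g := ⟨Matrix.of fun i j =>
      let x := g (symOfFn (Function.prod i j))
      let y := g (symOfFn (Function.prod j i))
      ⟨(x + y) / 2, (x - y) / 2⟩, by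
    refine mem_permInvariant.2 ⟨?_, fun π i j => ?_⟩
    · ext i j
      apply Complex.ext <;>
        simp only [Matrix.conjTranspose_apply, Matrix.of_apply, Complex.star_def,
          Complex.conj_re, Complex.conj_im] <;> ring
    · have hcomp (i j : Fin n → Fin d) :
          symOfFn (Function.prod (i ∘ π) (j ∘ π)) = symOfFn (Function.prod i j) :=
        symOfFn_comp_perm (Function.prod i j) π
      simp only [Matrix.of_apply, hcomp]⟩
  map_add' g h := by
    ext i j
    apply Complex.ext <;>
      simp only [Pi.add_apply, AddMemClass.mk_add_mk, Matrix.of_add_of, Matrix.of_apply,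
        Complex.add_re, Complex.add_im] <;> ring
  map_smul' c g := by
    ext i j
    apply Complex.ext <;>
      simp only [Pi.smul_apply, smul_eq_mul, RingHom.id_apply, SetLike.mk_smul_mk, Matrix.smul_of,
        Matrix.of_apply, Complex.smul_re, Complex.smul_im] <;> ring

theorem re_add_im_permInvariantOfSym (g : Sym (Fin d × Fin d) n → ℝ) (i j : Fin n → Fin d) :
    ((permInvariantOfSym d n g).1 i j).re + ((permInvariantOfSym d n g).1 i j).im =
      g (symOfFn (Function.prod i j)) := by
  simp only [permInvariantOfSym, LinearMap.coe_mk, AddHom.coe_mk, Matrix.of_apply]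
  ring

theorem permInvariantOfSym_injective : Function.Injective (permInvariantOfSym d n) := by
  intro g h hgh
  funext q
  obtain ⟨p, rfl⟩ := symOfFn_surjective q
  have hp := re_add_im_permInvariantOfSym g (Prod.fst ∘ p) (Prod.snd ∘ p)
  rw [hgh, re_add_im_permInvariantOfSym] at hp
  exact hp.symm

theorem permInvariantOfSym_surjective : Function.Surjective (permInvariantOfSym d n) := by
  intro A
  obtain ⟨hA, hinv⟩ := mem_permInvariant.1 A.2
  let c (p : Fin n → Fin d × Fin d) : ℝ :=
    (A.1 (Prod.fst ∘ p) (Prod.snd ∘ p)).re + (A.1 (Prod.fst ∘ p) (Prod.snd ∘ p)).im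
  have hc : c.FactorsThrough symOfFn := by
    intro p q hpq
    obtain ⟨π, rfl⟩ := exists_perm_of_symOfFn_eq hpq
    simp only [c, ← Function.comp_assoc, hinv]
  refine ⟨Function.extend symOfFn c 0, Subtype.ext ?_⟩
  refine eq_of_re_add_im_eq (mem_permInvariant.1 (Subtype.prop _)).1 hA fun i j => ?_
  rw [re_add_im_permInvariantOfSym, hc.extend_apply]
  rfl

theorem finrank_permInvariant (d n : ℕ) :
    Module.finrank ℝ (permInvariant d n) = (n + d ^ 2 - 1).choose n := by
  rw [← (LinearEquiv.ofBijective _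
      ⟨permInvariantOfSym_injective, permInvariantOfSym_surjective⟩).finrank_eq,
    Module.finrank_fintype_fun_eq_card, Sym.card_sym_eq_choose, Fintype.card_prod,
    Fintype.card_fin, ← sq, add_comm]

end PermInvariant

section TensorPow

variable {d : ℕ} (n : ℕ)

theorem tensorPow_mul (A B : Matrix (Fin d) (Fin d) ℂ) :
    tensorPow n (A * B) = tensorPow n A * tensorPow n B := by
  ext i j
  simp only [tensorPow, Matrix.of_apply, Matrix.mul_apply, ← Finset.prod_mul_distrib]
  rw [Finset.prod_univ_sum, Fintype.piFinset_univ]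

theorem conjTranspose_tensorPow (A : Matrix (Fin d) (Fin d) ℂ) :
    (tensorPow n A)ᴴ = tensorPow n Aᴴ := by
  ext i j
  simp [tensorPow]

theorem trace_tensorPow (A : Matrix (Fin d) (Fin d) ℂ) :
    (tensorPow n A).trace = A.trace ^ n := by
  simp only [tensorPow, Matrix.trace, Matrix.diag_apply, Matrix.of_apply]
  rw [← Fintype.piFinset_univ, ← Finset.prod_univ_sum (fun _ => Finset.univ) fun _ k => A k k,
    Finset.prod_const, Finset.card_univ, Fintype.card_fin]

theorem tensorPow_mem_permInvariant {A : Matrix (Fin d) (Fin d) ℂ} (hA : A.IsHermitian) :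
    tensorPow n A ∈ permInvariant d n := by
  refine mem_permInvariant.2 ⟨?_, fun π i j => ?_⟩
  · rw [Matrix.IsHermitian, conjTranspose_tensorPow, hA.eq]
  · exact Equiv.prod_comp π fun k => A (i k) (j k)

theorem posSemidef_tensorPow {A : Matrix (Fin d) (Fin d) ℂ} (hA : A.PosSemidef) :
    (tensorPow n A).PosSemidef := by
  obtain ⟨R, rfl⟩ := CStarAlgebra.nonneg_iff_eq_star_mul_self.1 hA.nonneg
  rw [Matrix.star_eq_conjTranspose, tensorPow_mul, ← conjTranspose_tensorPow]
  exact Matrix.posSemidef_conjTranspose_mul_self _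

theorem sqrt_tensorPow {A : Matrix (Fin d) (Fin d) ℂ} (hA : A.PosSemidef) :
    CFC.sqrt (tensorPow n A) = tensorPow n (CFC.sqrt A) :=
  CFC.sqrt_unique (by rw [← tensorPow_mul, CFC.sqrt_mul_sqrt_self A hA.nonneg])
    (posSemidef_tensorPow n (posSemidef_sqrt A)).nonneg

theorem traceNorm_tensorPow (A : Matrix (Fin d) (Fin d) ℂ) :
    traceNorm (tensorPow n A) = traceNorm A ^ n := by
  have hreal : ((CFC.sqrt (Aᴴ * A)).trace.re : ℂ) = (CFC.sqrt (Aᴴ * A)).trace :=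
    (Complex.eq_re_of_ofReal_le (posSemidef_sqrt _).trace_nonneg).symm
  rw [traceNorm, traceNorm, conjTranspose_tensorPow, ← tensorPow_mul,
    sqrt_tensorPow n (Matrix.posSemidef_conjTranspose_mul_self A), trace_tensorPow,
    ← hreal, ← Complex.ofReal_pow, Complex.ofReal_re, Complex.ofReal_re]

theorem fidelity_tensorPow {ρ σ : Matrix (Fin d) (Fin d) ℂ} (hρ : ρ.PosSemidef)
    (hσ : σ.PosSemidef) : fidelity (tensorPow n ρ) (tensorPow n σ) = fidelity ρ σ ^ n := by
  rw [fidelity, sqrt_tensorPow n hρ, sqrt_tensorPow n hσ, ← tensorPow_mul, traceNorm_tensorPow,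
    fidelity]

end TensorPow

section AffineDim

theorem finrank_vectorSpan_add_one_le {K V V' : Type*} [DivisionRing K] [AddCommGroup V]
    [Module K V] [AddCommGroup V'] [Module K V'] {W : Submodule K V} [FiniteDimensional K W]
    {S : Set V} (hS : S.Nonempty) (hSW : S ⊆ W) (f : V →ₗ[K] V') {c : V'} (hc : c ≠ 0)
    (hf : ∀ x ∈ S, f x = c) : Module.finrank K (vectorSpan K S) + 1 ≤ Module.finrank K W := by
  have hle : vectorSpan K S ≤ W ⊓ LinearMap.ker f := by
    rw [vectorSpan_def, Submodule.span_le]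
    rintro _ ⟨x, hx, y, hy, rfl⟩
    exact ⟨W.sub_mem (hSW hx) (hSW hy), by simp [hf x hx, hf y hy]⟩
  obtain ⟨x, hx⟩ := hS
  have hlt : vectorSpan K S < W :=
    SetLike.lt_iff_le_and_exists.2 ⟨hle.trans inf_le_left, x, hSW hx, fun hmem =>
      hc ((hf x hx).symm.trans (hle hmem).2)⟩
  exact Submodule.finrank_lt_finrank_of_lt hlt

variable {d : ℕ} (n : ℕ)

theorem affineDim_copies_add_one_le (hd : 0 < d) {D : Set (Matrix (Fin d) (Fin d) ℂ)}
    (hD : D ⊆ densityMatrices d) : affineDim (copies n D) + 1 ≤ (n + d ^ 2 - 1).choose n := by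
  rw [affineDim, direction_affineSpan]
  rcases D.eq_empty_or_nonempty with rfl | hne
  · rw [copies, Set.image_empty, vectorSpan_empty, finrank_bot, zero_add]
    have hpos : 0 < d ^ 2 := by positivity
    exact Nat.choose_pos (by lia)
  · rw [← finrank_permInvariant]
    refine finrank_vectorSpan_add_one_le (hne.image _) ?_ (Matrix.traceLinearMap _ ℝ ℂ)
      one_ne_zero ?_
    · rintro _ ⟨ρ, hρ, rfl⟩
      exact tensorPow_mem_permInvariant n (hD hρ).1.1
    · rintro _ ⟨ρ, hρ, rfl⟩
      rw [Matrix.traceLinearMap_apply, trace_tensorPow, (hD hρ).2, one_pow]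

end AffineDim

section SupFidelity

theorem bddAbove_fidelityValues {d : ℕ} {D₁ D₂ : Set (Matrix (Fin d) (Fin d) ℂ)}
    (hD₁ : D₁ ⊆ densityMatrices d) (hD₂ : D₂ ⊆ densityMatrices d) :
    BddAbove (fidelityValues D₁ D₂) := by
  refine ⟨1, ?_⟩
  rintro _ ⟨ρ, hρ, σ, hσ, rfl⟩
  have h := two_mul_fidelity_le (hD₁ hρ).1 (hD₂ hσ).1
  rw [(hD₁ hρ).2, (hD₂ hσ).2, Complex.one_re] at h
  linarith

theorem supFidelity_nonneg {ι : Type*} [Fintype ι] [DecidableEq ι] (A B : Set (Matrix ι ι ℂ)) :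
    0 ≤ supFidelity A B := by
  refine Real.sSup_nonneg ?_
  rintro _ ⟨ρ, _, σ, _, rfl⟩
  exact fidelity_nonneg ρ σ

theorem mem_upperBounds_fidelityValues_hullCopies (n : ℕ) {d : ℕ}
    {D₁ D₂ : Set (Matrix (Fin d) (Fin d) ℂ)}
    (hD₁ : D₁ ⊆ densityMatrices d) (hD₂ : D₂ ⊆ densityMatrices d) :
    √((affineDim (copies n D₁) + 1) * (affineDim (copies n D₂) + 1)) * supFidelity D₁ D₂ ^ n ∈
      upperBounds (fidelityValues (hullCopies n D₁) (hullCopies n D₂)) := by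
  rintro _ ⟨ρ, hρ, σ, hσ, rfl⟩
  refine fidelity_convexHull_le ?_ ?_ ?_ hρ hσ
  · rintro _ ⟨ρ, hρ, rfl⟩
    exact posSemidef_tensorPow n (hD₁ hρ).1
  · rintro _ ⟨σ, hσ, rfl⟩
    exact posSemidef_tensorPow n (hD₂ hσ).1
  · rintro _ ⟨ρ, hρ, rfl⟩ _ ⟨σ, hσ, rfl⟩
    rw [fidelity_tensorPow n (hD₁ hρ).1 (hD₂ hσ).1]
    exact pow_le_pow_left₀ (fidelity_nonneg ρ σ)
      (le_csSup (bddAbove_fidelityValues hD₁ hD₂) ⟨ρ, hρ, σ, hσ, rfl⟩) n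

theorem sqrt_add_one_mul_add_one_le_max (a b : ℕ) :
    √((a + 1) * (b + 1)) ≤ ((max a b : ℕ) + 1 : ℝ) := by
  refine Real.sqrt_le_iff.2 ⟨by positivity, ?_⟩
  rw [sq]
  gcongr
  · exact le_max_left a b
  · exact le_max_right a b

end SupFidelity

end CompositeQHT

theorem mainTheorem9_general (d n : ℕ) (hd : 0 < d) (D₁ D₂ : Set (Matrix (Fin d) (Fin d) ℂ))
    (hD₁ : D₁ ⊆ CompositeQHT.densityMatrices d) (hD₂ : D₂ ⊆ CompositeQHT.densityMatrices d) :
    BddAbove (CompositeQHT.fidelityValues D₁ D₂) ∧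
    BddAbove (CompositeQHT.fidelityValues
      (CompositeQHT.hullCopies n D₁) (CompositeQHT.hullCopies n D₂)) ∧
    CompositeQHT.supFidelity (CompositeQHT.hullCopies n D₁) (CompositeQHT.hullCopies n D₂) ≤
      √((CompositeQHT.affineDim (CompositeQHT.copies n D₁) + 1) *
          (CompositeQHT.affineDim (CompositeQHT.copies n D₂) + 1)) *
        CompositeQHT.supFidelity D₁ D₂ ^ n ∧
    CompositeQHT.affineDim (CompositeQHT.copies n D₁) + 1 ≤ (n + d ^ 2 - 1).choose n ∧
    CompositeQHT.affineDim (CompositeQHT.copies n D₂) + 1 ≤ (n + d ^ 2 - 1).choose n ∧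
    Module.finrank ℝ (CompositeQHT.permInvariant d n) = (n + d ^ 2 - 1).choose n := by
  have hbound := CompositeQHT.mem_upperBounds_fidelityValues_hullCopies n hD₁ hD₂
  have hsup := CompositeQHT.supFidelity_nonneg D₁ D₂
  exact ⟨CompositeQHT.bddAbove_fidelityValues hD₁ hD₂, ⟨_, hbound⟩,
    Real.sSup_le hbound (by positivity),
    CompositeQHT.affineDim_copies_add_one_le n hd hD₁,
    CompositeQHT.affineDim_copies_add_one_le n hd hD₂,
    CompositeQHT.finrank_permInvariant d n⟩

theorem mainTheorem9 (d n : ℕ) (hd : 0 < d)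
    (D₁ D₂ : Set (Matrix (Fin d) (Fin d) ℂ))
    (hD₁ : D₁ ⊆ CompositeQHT.densityMatrices d) (hD₂ : D₂ ⊆ CompositeQHT.densityMatrices d)
    (hc₁ : IsCompact D₁) (hc₂ : IsCompact D₂) :
    -- both suprema are finite
    BddAbove (CompositeQHT.fidelityValues D₁ D₂) ∧
    BddAbove (CompositeQHT.fidelityValues
      (CompositeQHT.hullCopies n D₁) (CompositeQHT.hullCopies n D₂)) ∧
    -- the bound on the fidelity between the convex hulls
    CompositeQHT.supFidelity (CompositeQHT.hullCopies n D₁) (CompositeQHT.hullCopies n D₂) ≤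
      ((max (CompositeQHT.affineDim (CompositeQHT.copies n D₁))
          (CompositeQHT.affineDim (CompositeQHT.copies n D₂)) : ℕ) + 1 : ℝ) *
        CompositeQHT.supFidelity D₁ D₂ ^ n ∧
    -- the bound on the dimensions
    CompositeQHT.affineDim (CompositeQHT.copies n D₁) + 1 ≤ (n + d ^ 2 - 1).choose n ∧
    CompositeQHT.affineDim (CompositeQHT.copies n D₂) + 1 ≤ (n + d ^ 2 - 1).choose n ∧
    -- the binomial coefficient is the dimension of the permutation-invariant Hermitian operators
    Module.finrank ℝ (CompositeQHT.permInvariant d n) = (n + d ^ 2 - 1).choose n := by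
  obtain ⟨hbdd, hbdd_hull, hle, hdims⟩ := mainTheorem9_general d n hd D₁ D₂ hD₁ hD₂
  exact ⟨hbdd, hbdd_hull, hle.trans (mul_le_mul_of_nonneg_right
    (CompositeQHT.sqrt_add_one_mul_add_one_le_max _ _)
    (pow_nonneg (CompositeQHT.supFidelity_nonneg D₁ D₂) n)), hdims⟩
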